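/- Consider a block lower Hessenberg branching process: a multitype Galton--Watson process $\{Z_n\}$ with type set $\mathcal X_d=\{\langle k,i\rangle: k\ge 0,\ 1\le i\le d\}$ (level $k$, phase $i$), in which individuals reproduce independently according to an offspring law depending on their type, and an individual of level $k$ has no children of level larger than $k+1$. Let $A_i=\{\langle k,i\rangle:k\ge0\}$, let $M(i,j)\in[0,\infty]$ be the expected number of type-$j$ children of a type-$i$ parent, and call the process irreducible if in the directed graph with edges $i\to j$ whenever $M(i,j)>0$ every type can be reached from every type. For $B\subseteq\mathcal X_d$ let $\mathbf q(B)$ be the vector, indexed by the type of the initial individual, of the probabilities that from some generation on no individual with type in $B$ appears; let $\mathbf q=\mathbf q(\mathcal X_d)$ (global extinction), and let $\tilde{\mathbf q}$ be the vector of the probabilities that for every $k$ the types of level at most $k$ become extinct (partial extinction). Let $\tilde{\mathbf q}^{(B)}$ be the vector of global extinction probabilities of the process in which all individuals with type outside $B$ are sterile, and let $\tilde M^{(B)}=(M(i,j))_{i,j\in B}$. For vectors, $\mathbf x<\mathbf y$ means $x_i\le y_i$ for all $i$ and $x_i<y_i$ for at least one $i$. Let $A\in\sigma(A_1,\dots,A_d)$,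 $\bar A=\mathcal X_d\setminus A$, $\bar A(k)$ the set of types of level $k$ in $\bar A$, and $v$ the number of phases in $\bar A$. Put $W=\tilde M^{(\bar A)}$, with $v\times v$ blocks $W_{kl}=(M(i,j))_{i\in\bar A(k),\,j\in\bar A(l)}$, and - $\nu(W)=\sup_{i,j\in\bar A}\limsup_n\big((W^n)_{ij}\big)^{1/n}$; - $\tilde{\mathcal M}_k=\sum_{n\ge0}(W^{(k)})^n\,W_{k,k+1}$ for $k\ge0$, where $W^{(k)}=\sum_{i=0}^{k}W_{ki}\,\tilde{\mathcal M}_i\tilde{\mathcal M}_{i+1}\cdots\tilde{\mathcal M}_{k-1}$ (the empty product, for $i=k$, is the identity), and $\tilde{\mathcal M}_{0\to k-1}=\tilde{\mathcal M}_0\cdots\tilde{\mathcal M}_{k-1}$ (the identity for $k=0$), all with entries in $[0,\infty]$; - $\mathbf t_k=(t_{k,i})_{i\in\bar A(k)}$ with $t_{k,i}=\sum_{j\in A}M(i,j)$; - $\tilde F_k=(\tilde F_k(i,j))_{i,j\in\bar A(k)}$ with $\tilde F_k(i,i)=1$ and, for $i\ne j$, $\tilde F_k(i,j)=W(i,j)+\sum_{n\ge1}\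 \sum_{i_1,\dots,i_n\in\bar A\setminus\{j\}}W(i,i_1)W(i_1,i_2)\cdots W(i_n,j)$. Assume that $\tilde q^{(\bar A)}_i<1$ for at least one type $i$ of level $0$, that $\nu(\tilde M^{(\bar A)})<1$, and that (A) $\sum_{k=0}^\infty(\mathbf 1_v^\top\mathbf t_k)\,\tilde{\mathcal M}_{0\to k-1}\mathbf 1_v<\infty$ (in every entry), and (B) there is $K<\infty$ such that $\tilde F_k(i,j)\le K$ for all $k\ge0$ and all $i,j\in\bar A(k)$. Then $\mathbf q<\mathbf q(A)$. If, in addition, $\{Z_n\}$ is irreducible, then $\mathbf q(\bar A)<\tilde{\mathbf q}$. -/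

import Mathlib

open MeasureTheory Set Filter
open scoped ENNReal NNReal

namespace BlockLHBP

/-! ### Types, levels and phases -/

/-- Types `⟨k, i⟩`: level `k ≥ 0` and one of `d` phases. -/
abbrev Ty (d : ℕ) : Type := ℕ × Fin d

/-- The set `A_i` of all types of phase `i`. -/
def phaseClass (d : ℕ) (i : Fin d) : Set (Ty d) := {x | x.2 = i}

/-- The sigma algebra `σ(A_1, …, A_d)` generated by the phase partition. -/
abbrev phaseSigma (d : ℕ) : MeasurableSpace (Ty d) :=
  MeasurableSpace.generateFrom (Set.range (phaseClass d))

/-- The set `T_k` of types of level at most `k`. -/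
def upToLevel (d k : ℕ) : Set (Ty d) := {x | x.1 ≤ k}

/-! ### The offspring laws -/

/-- Offspring vectors: the number of children of each type. An individual of level `k` only has
children of the finitely many types of level at most `k + 1`, so these vectors have finite
support. -/
abbrev Offspring (d : ℕ) : Type := Ty d →₀ ℕ

instance instMeasurableSpaceOffspring (d : ℕ) : MeasurableSpace (Offspring d) := ⊤

/-- The data of a block lower Hessenberg branching process: for every type `j` an offspring
distribution `law j` such that an individual of level `k` has no child of level larger than
`k + 1`. -/
structure OffspringLaws (d : ℕ) where
  law : Ty d → PMF (Offspring d)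
  hessenberg : ∀ j : Ty d, ∀ r ∈ (law j).support, ∀ l : Ty d, j.1 + 1 < l.1 → r l = 0

/-! ### The family tree on the Ulam-Harris space -/

/-- Virtual individuals of the tree with root type `φ`: `(φ, [])` is the root, and
`(φ, (l, m) :: I)` is the `m`-th (counting from zero) child of type `l` of `(φ, I)`. -/
abbrev Label (d : ℕ) : Type := Ty d × List (Ty d × ℕ)

/-- The type of a virtual individual. -/
def typeOf {d : ℕ} : Label d → Ty d
  | (φ, []) => φ
  | (_, (l, _) :: _) => l

/-- A sample point assigns an offspring vector `ω I` to every virtual individual `I`. -/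
abbrev Sample (d : ℕ) : Type := Label d → Offspring d

/-- The probability measure under which the offspring vectors of the virtual individuals are
independent and that of `I` is distributed according to the law of the type of `I`. -/
noncomputable def prob {d : ℕ} (P : OffspringLaws d) : Measure (Sample d) :=
  Measure.infinitePi fun I : Label d => (P.law (typeOf I)).toMeasure

/-- `Appears ω φ I`: the virtual individual `(φ, I)` appears in the population that descends from
one individual of type `φ`. -/
def Appears {d : ℕ} (ω : Sample d) (φ : Ty d) : List (Ty d × ℕ) → Prop
  | [] => True
  | (l, m) :: I => Appears ω φ I ∧ m < ω (φ, I) l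

/-- `Z ω φ n j` is the number of individuals of type `j` in generation `n`, when the population
begins with one individual of type `φ`. -/
noncomputable def Z {d : ℕ} (ω : Sample d) (φ : Ty d) (n : ℕ) (j : Ty d) : ℕ∞ :=
  Set.encard {I : List (Ty d × ℕ) | I.length = n ∧ Appears ω φ I ∧ typeOf (φ, I) = j}

open scoped Classical in
/-- The offspring vectors of the process in which the types outside `B` are sterile. -/
noncomputable def sterilize {d : ℕ} (B : Set (Ty d)) (ω : Sample d) : Sample d :=
  fun I => if typeOf I ∈ B then ω I else 0

/-! ### Extinction events and extinction probabilities -/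

/-- The event `E_n(A)` that no individual with type in `A` appears from generation `n` on. -/
def extinctFrom {d : ℕ} (φ : Ty d) (A : Set (Ty d)) (n : ℕ) : Set (Sample d) :=
  {ω | ∀ l, n ≤ l → ∀ i ∈ A, Z ω φ l i = 0}

/-- The event `E(A)`, the increasing limit of the events `E_n(A)`, of extinction in `A`. -/
def extinct {d : ℕ} (φ : Ty d) (A : Set (Ty d)) : Set (Sample d) :=
  ⋃ n, extinctFrom φ A n

/-- The vector `q(A)` of the probabilities of extinction in `A`. -/
noncomputable def qSet {d : ℕ} (P : OffspringLaws d) (A : Set (Ty d)) : Ty d → ℝ≥0∞ :=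
  fun φ => prob P (extinct φ A)

/-- The vector `q` of global extinction probabilities. -/
noncomputable def qGlobal {d : ℕ} (P : OffspringLaws d) : Ty d → ℝ≥0∞ :=
  qSet P Set.univ

/-- The vector `q̃` of partial extinction probabilities. -/
noncomputable def qPartial {d : ℕ} (P : OffspringLaws d) : Ty d → ℝ≥0∞ :=
  fun φ => prob P (⋂ k : ℕ, extinct φ (upToLevel d k))

/-- The vector `q̃^(B)`: the global extinction probabilities of the process in which the types
outside `B` are sterile. -/
noncomputable def qSterile {d : ℕ} (P : OffspringLaws d) (B : Set (Ty d)) : Ty d → ℝ≥0∞ :=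
  fun φ => prob P {ω | sterilize B ω ∈ extinct φ Set.univ}

/-! ### The mean progeny matrix

All matrices have entries in `[0, ∞]`, so every series below has a value and an infinite mean is
the entry `∞`. -/

/-- The mean progeny matrix: `M(i, j)` is the expected number of type-`j` children of a parent of
type `i`, that is, the derivative at `𝟏` of the generating function `∑ r, p_i(r) s ^ r` with
respect to `s_j`. -/
noncomputable def meanMatrix {d : ℕ} (P : OffspringLaws d) (i j : Ty d) : ℝ≥0∞ :=
  ∑' r : Offspring d, P.law i r * (r j : ℝ≥0∞)

/-- The process is irreducible if in the graph with an edge from `i` to `j` whenever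
`M(i, j) > 0` there is a path from every type to every type. -/
def Irreducible {d : ℕ} (P : OffspringLaws d) : Prop :=
  ∀ i j : Ty d, Relation.ReflTransGen (fun a b => 0 < meanMatrix P a b) i j

/-- The submatrix `M̃^(B)` of the mean progeny matrix restricted to the types in `B`. -/
noncomputable def subMatrix {d : ℕ} (P : OffspringLaws d) (B : Set (Ty d)) (i j : B) : ℝ≥0∞ :=
  meanMatrix P i j

open scoped Classical in
/-- Powers of a nonnegative matrix with an arbitrary index set. -/
noncomputable def matPow {ι : Type*} (W : ι → ι → ℝ≥0∞) : ℕ → ι → ι → ℝ≥0∞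
  | 0 => fun i j => if i = j then 1 else 0
  | n + 1 => fun i j => ∑' l, W i l * matPow W n l j

/-- The convergence norm `ν(W) = sup_{i,j} limsup_n ((W ^ n) i j) ^ (1 / n)`. -/
noncomputable def convNorm {ι : Type*} (W : ι → ι → ℝ≥0∞) : ℝ≥0∞ :=
  ⨆ i, ⨆ j, limsup (fun n : ℕ => matPow W n i j ^ (1 / (n : ℝ))) atTop

/-! ### First passage paths within a level -/

/-- The weighted sum of the paths `i → i₁ → ⋯ → iₙ → j` with all of `i₁, …, iₙ` different from
`j`. -/
noncomputable def firstPassage {ι : Type*} (W : ι → ι → ℝ≥0∞) : ℕ → ι → ι → ℝ≥0∞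
  | 0 => W
  | n + 1 => fun i j => ∑' l : {l : ι // l ≠ j}, W i l * firstPassage W n l j

open scoped Classical in
/-- First passage matrices: `1` on the diagonal, and otherwise the weighted sum of all first
passage paths from `i` to `j`. The matrix `F̃_k^(B)` is the restriction of
`firstPassageSum (subMatrix P B)` to the types of level `k`. -/
noncomputable def firstPassageSum {ι : Type*} (W : ι → ι → ℝ≥0∞) (i j : ι) : ℝ≥0∞ :=
  if i = j then 1 else ∑' n, firstPassage W n i j

/-! ### Step-up matrices -/

/-- The step-up matrices `𝓜_k = ∑ n, (M^(k)) ^ n * M_{k,k+1}` of a block matrix with blocks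
`W k l = M_{kl}`, where `M^(k) = ∑ i ≤ k, M_{ki} * (𝓜_i * ⋯ * 𝓜_{k-1})`. -/
noncomputable def stepUp {ι : Type*} [Fintype ι] [DecidableEq ι]
    (W : ℕ → ℕ → Matrix ι ι ℝ≥0∞) (k : ℕ) : Matrix ι ι ℝ≥0∞ :=
  Matrix.of fun p r => ∑' n : ℕ,
    ((∑ i : Fin (k + 1),
        W k i * (List.ofFn fun j : Fin (k - i) => stepUp W (i + j)).prod) ^ n
      * W k (k + 1)) p r
termination_by k
decreasing_by omega

/-- The product `𝓜_{0→k-1} = 𝓜_0 * 𝓜_1 * ⋯ * 𝓜_{k-1}`, the identity for `k = 0`. -/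
noncomputable def stepUpProd {ι : Type*} [Fintype ι] [DecidableEq ι]
    (W : ℕ → ℕ → Matrix ι ι ℝ≥0∞) (k : ℕ) : Matrix ι ι ℝ≥0∞ :=
  (List.ofFn fun j : Fin k => stepUp W j).prod

/-- The phases that occur in `B`. If `B ∈ σ(A_1, …, A_d)`, then `B` consists of all types with a
phase in this set. -/
def phases {d : ℕ} (B : Set (Ty d)) : Set (Fin d) := Prod.snd '' B

noncomputable instance instFintypePhases {d : ℕ} (B : Set (Ty d)) : Fintype (phases B) :=
  Fintype.ofFinite _

/-- The blocks of `M̃^(B)` for `B ∈ σ(A_1, …, A_d)`, as matrices indexed by the phases of `B`. -/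
noncomputable def subBlock {d : ℕ} (P : OffspringLaws d) (B : Set (Ty d)) (k l : ℕ) :
    Matrix (phases B) (phases B) ℝ≥0∞ :=
  Matrix.of fun p r => meanMatrix P (k, p) (l, r)

/-- The vector `t_k^(Ā)`: the expected number of children in `A` of a parent of level `k` with
a phase of `Ā`. -/
noncomputable def tVec {d : ℕ} (P : OffspringLaws d) (A : Set (Ty d)) (k : ℕ) (p : phases Aᶜ) : ℝ≥0∞ :=
  ∑' j : A, meanMatrix P (k, p) j

end BlockLHBP

namespace BlockLHBP

/-! ### Powers and Green functions of nonnegative matrices -/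

section Matrices

variable {ι : Type*} (W : ι → ι → ℝ≥0∞)

/-! Write `B = Aᶜ` and make the types of `A` sterile. The expected number of individuals of `A` ever
born from a type `i` of `B` is `∑ j, G(i, j) t_j`, with `G` the Green function of `M̃^(B)`. Since `ν
< 1`, the diagonal of `G` is bounded by a geometric series; condition (B) and first passage extend
the bound to each level. A path climbs at most one level per step, so `G` from level 0 to level `k`
is at most the step-up product times `G` within level `k` (`green_le_stepUpProd_mul`), and (A) makes
the sum finite (`tsum_green_mul_lt_top`).

Hence almost surely only finitely many individuals of `A` are born. If no type of `B` could survive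
with all its descendants in `B`, then on survival births in `A` would occur in arbitrarily late
generations. So some type `i` of `B`, of whatever level, has `survivesWithin` with positive
probability (`exists_treeProb_survivesWithin_pos`).

On this event `A` never appears, yet the population survives: this separates `q` from `q(A)`. Also,
`B` does not become extinct there, whereas `ν < 1` makes each single type of `B` die out: this
separates `q(B)` from `q̃`. The inequality `q(B) ≤ q̃` comes from Lévy's zero-one law: by
irreducibility each appearance of a type gives `B` a fixed positive chance to reappear
(`ae_treeExtinct_singleton_of_treeExtinct`). -/

theorem matPow_zero_self (i : ι) : matPow W 0 i i = 1 := by simp [matPow]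

theorem matPow_zero_ne {i j : ι} (h : i ≠ j) : matPow W 0 i j = 0 := by simp [matPow, h]

theorem matPow_succ (n : ℕ) (i j : ι) :
    matPow W (n + 1) i j = ∑' l, W i l * matPow W n l j := rfl

theorem tsum_matPow_zero_mul (i : ι) (f : ι → ℝ≥0∞) : ∑' l, matPow W 0 i l * f l = f i := by
  rw [tsum_eq_single i fun l hl => by simp [matPow_zero_ne W hl.symm]]
  simp [matPow_zero_self]

theorem tsum_mul_matPow_zero (j : ι) (f : ι → ℝ≥0∞) : ∑' l, f l * matPow W 0 l j = f j := by
  rw [tsum_eq_single j fun l hl => by simp [matPow_zero_ne W hl]]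
  simp [matPow_zero_self]

theorem matPow_add (m n : ℕ) (i j : ι) :
    matPow W (m + n) i j = ∑' l, matPow W m i l * matPow W n l j := by
  induction m generalizing i with
  | zero => rw [tsum_matPow_zero_mul, zero_add]
  | succ m ih =>
    rw [show m + 1 + n = m + n + 1 by omega, matPow_succ]
    simp_rw [ih, matPow_succ, ← ENNReal.tsum_mul_left, ← ENNReal.tsum_mul_right]
    rw [ENNReal.tsum_comm]
    simp_rw [mul_assoc]

theorem matPow_one (i j : ι) : matPow W 1 i j = W i j := by
  rw [matPow_succ, tsum_mul_matPow_zero]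

theorem matPow_succ_right (n : ℕ) (i j : ι) :
    matPow W (n + 1) i j = ∑' l, matPow W n i l * W l j := by
  rw [matPow_add]
  simp_rw [matPow_one]

theorem matPow_self_pow_le (n k : ℕ) (j : ι) : matPow W n j j ^ k ≤ matPow W (n * k) j j := by
  induction k with
  | zero => simp [matPow_zero_self]
  | succ k ih =>
    rw [Nat.mul_succ, matPow_add, pow_succ]
    exact (mul_le_mul_left ih _).trans
      (ENNReal.le_tsum (f := fun l => matPow W (n * k) j l * matPow W n l j) j)

variable {W}

theorem eventually_matPow_le {ρ : ℝ≥0∞} (h : convNorm W < ρ) (i j : ι) :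
    ∀ᶠ n in atTop, matPow W n i j ≤ ρ ^ n := by
  have h1 : limsup (fun n : ℕ => matPow W n i j ^ (1 / (n : ℝ))) atTop < ρ :=
    (le_iSup₂ (f := fun i j => limsup (fun n : ℕ => matPow W n i j ^ (1 / (n : ℝ))) atTop)
      i j).trans_lt h
  filter_upwards [eventually_lt_of_limsup_lt h1, eventually_gt_atTop 0] with n hn hpos
  have hn0 : (0 : ℝ) < n := by exact_mod_cast hpos
  have := ENNReal.rpow_le_rpow hn.le hn0.le
  rwa [← ENNReal.rpow_mul, one_div_mul_cancel hn0.ne', ENNReal.rpow_one, ENNReal.rpow_natCast]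
    at this

/-- Supermultiplicativity of the diagonal removes the "eventually" in the root bound: bound a high
power of the `n`-th entry and take roots. -/
theorem matPow_self_le {ρ : ℝ≥0∞} (h : convNorm W < ρ) (n : ℕ) (j : ι) :
    matPow W n j j ≤ ρ ^ n := by
  rcases Nat.eq_zero_or_pos n with rfl | hn
  · simp [matPow_zero_self]
  obtain ⟨N, hN⟩ := eventually_atTop.1 (eventually_matPow_le h j j)
  have h1 := (matPow_self_pow_le W n (N + 1) j).trans
    (hN (n * (N + 1)) (by nlinarith))
  rw [pow_mul] at h1
  exact (ENNReal.pow_le_pow_left_iff (Nat.succ_ne_zero N)).1 h1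

variable (W)

/-- The Green function `∑ n, W ^ n`. -/
noncomputable def green (i j : ι) : ℝ≥0∞ := ∑' n, matPow W n i j

theorem green_eq (i j : ι) : green W i j = matPow W 0 i j + ∑' l, W i l * green W l j := by
  unfold green
  rw [tsum_eq_zero_add' ENNReal.summable]
  simp_rw [matPow_succ, ← ENNReal.tsum_mul_left]
  rw [ENNReal.tsum_comm]

/-- The Green function is the least supersolution of the Poisson equation. -/
theorem green_le_of_supersolution (j : ι) (h : ι → ℝ≥0∞)
    (hh : ∀ i, matPow W 0 i j + ∑' l, W i l * h l ≤ h i) (i : ι) : green W i j ≤ h i := by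
  unfold green
  rw [ENNReal.tsum_eq_iSup_nat]
  refine iSup_le fun N => ?_
  induction N generalizing i with
  -- The partial sums are the iterates from zero of a monotone affine map that sends `h` below
  -- itself.
  | zero => simp
  | succ N ih =>
    rw [Finset.sum_range_succ', add_comm]
    refine le_trans ?_ (hh i)
    gcongr
    simp_rw [matPow_succ]
    rw [← Summable.tsum_finsetSum fun _ _ => ENNReal.summable]
    refine ENNReal.tsum_le_tsum fun l => ?_
    rw [← Finset.mul_sum]
    gcongr
    exact ih l

theorem green_self_le {ρ : ℝ≥0∞} (h : convNorm W < ρ) (j : ι) : green W j j ≤ (1 - ρ)⁻¹ := by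
  rw [← ENNReal.tsum_geometric]
  exact ENNReal.tsum_le_tsum fun n => matPow_self_le h n j

theorem tsum_eq_add_tsum_ne (j : ι) (f : ι → ℝ≥0∞) :
    ∑' l, f l = f j + ∑' l : {l : ι // l ≠ j}, f l := by
  classical
  rw [ENNReal.tsum_eq_add_tsum_ite j]
  congr 1
  refine Eq.trans ?_ (tsum_subtype {l | l ≠ j} f).symm
  refine tsum_congr fun l => ?_
  by_cases hl : l = j <;> simp [Set.indicator, hl]

/-- Decomposition of a path from `i` to `j` at its first passage through `j`. -/
theorem matPow_succ_eq_sum_firstPassage (n : ℕ) (i j : ι) :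
    matPow W (n + 1) i j =
      ∑ x ∈ Finset.HasAntidiagonal.antidiagonal n, firstPassage W x.1 i j * matPow W x.2 j j := by
  induction n generalizing i with
  | zero => simp [matPow_one, firstPassage, matPow_zero_self]
  | succ n ih =>
    rw [matPow_succ, tsum_eq_add_tsum_ne j, Finset.Nat.sum_antidiagonal_succ]
    congr 1
    simp_rw [ih, firstPassage, ← ENNReal.tsum_mul_right]
    rw [← Summable.tsum_finsetSum fun _ _ => ENNReal.summable]
    simp_rw [Finset.mul_sum, mul_assoc]

/-- Summing the first passage decomposition over all lengths turns the convolution into a product of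
sums. -/
theorem green_le_firstPassageSum_mul (i j : ι) :
    green W i j ≤ firstPassageSum W i j * green W j j := by
  by_cases hij : i = j
  · simp [firstPassageSum, hij]
  · rw [firstPassageSum, if_neg hij, green, tsum_eq_zero_add' ENNReal.summable,
      matPow_zero_ne W hij, zero_add, green, ← ENNReal.tsum_mul_right]
    simp_rw [matPow_succ_eq_sum_firstPassage, ← ENNReal.tsum_mul_left]
    rw [← ENNReal.tsum_prod (f := fun a b => firstPassage W a i j * matPow W b j j)]
    rw [← Finset.HasAntidiagonal.sigmaAntidiagonalEquivProd.tsum_eq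
      (fun x : ℕ × ℕ => firstPassage W x.1 i j * matPow W x.2 j j), ENNReal.tsum_sigma']
    refine (tsum_congr fun n => ?_).le
    rw [tsum_fintype]
    exact (Finset.sum_coe_sort (Finset.HasAntidiagonal.antidiagonal n)
      (fun x => firstPassage W x.1 i j * matPow W x.2 j j)).symm

end Matrices

/-! ### Step-up matrices and Green functions of block lower Hessenberg matrices -/

section StepUp

variable {ι : Type*} [Fintype ι]

theorem mulVec_mono (M : Matrix ι ι ℝ≥0∞) {v w : ι → ℝ≥0∞} (h : v ≤ w) :
    M.mulVec v ≤ M.mulVec w := fun p => by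
  simp only [Matrix.mulVec, dotProduct]
  gcongr with q
  exact h q

theorem mulVec_tsum (M : Matrix ι ι ℝ≥0∞) (f : ℕ → ι → ℝ≥0∞) (p : ι) :
    M.mulVec (fun q => ∑' n, f n q) p = ∑' n, M.mulVec (f n) p := by
  simp only [Matrix.mulVec, dotProduct]
  simp_rw [← ENNReal.tsum_mul_left]
  rw [← Summable.tsum_finsetSum fun _ _ => ENNReal.summable]

/-- The blocks of a matrix indexed by levels and phases. -/
def blocks (U : ℕ × ι → ℕ × ι → ℝ≥0∞) (k l : ℕ) : Matrix ι ι ℝ≥0∞ := Matrix.of fun p r => U (k, p) (l, r)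

theorem tsum_mul_eq_blocks {U : ℕ × ι → ℕ × ι → ℝ≥0∞}
    (hU : ∀ k l p r, k + 1 < l → U (k, p) (l, r) = 0)
    (f : ℕ → ι → ℝ≥0∞) (l : ℕ) (p : ι) :
    ∑' x : ℕ × ι, U (l, p) x * f x.1 x.2 =
      ∑ i : Fin (l + 1), (blocks U l i).mulVec (f i) p +
        (blocks U l (l + 1)).mulVec (f (l + 1)) p := by
  rw [ENNReal.tsum_prod']
  simp_rw [tsum_fintype]
  have h : ∀ i, ∑ r, U (l, p) (i, r) * f i r = (blocks U l i).mulVec (f i) p := fun i => rfl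
  simp_rw [h]
  rw [tsum_eq_sum (s := Finset.range (l + 2)), Finset.sum_range_succ,
    Fin.sum_univ_eq_sum_range (fun i => (blocks U l i).mulVec (f i) p)]
  intro i hi
  rw [← h]
  refine Finset.sum_eq_zero fun r _ => ?_
  rw [hU _ _ _ _ (by simp only [Finset.mem_range, not_lt] at hi; omega), zero_mul]

variable [DecidableEq ι] (W : ℕ → ℕ → Matrix ι ι ℝ≥0∞)

/-- The product `𝓜_i * ⋯ * 𝓜_{k-1}`. -/
noncomputable def stepUpRange (i k : ℕ) : Matrix ι ι ℝ≥0∞ :=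
  (List.ofFn fun j : Fin (k - i) => stepUp W (i + j)).prod

theorem stepUpRange_self (i : ℕ) : stepUpRange W i i = 1 := by
  unfold stepUpRange
  rw [List.ofFn_congr (Nat.sub_self i)]
  simp

theorem stepUpRange_succ {i k : ℕ} (h : i ≤ k) :
    stepUpRange W i (k + 1) = stepUpRange W i k * stepUp W k := by
  unfold stepUpRange
  rw [List.ofFn_congr (show k + 1 - i = (k - i) + 1 by omega), List.ofFn_succ']
  simp [List.concat_eq_append, Nat.add_sub_cancel' h]

theorem stepUpRange_mul {i l k : ℕ} (hil : i ≤ l) (hlk : l ≤ k) :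
    stepUpRange W i l * stepUpRange W l k = stepUpRange W i k := by
  induction k, hlk using Nat.le_induction with
  | base => rw [stepUpRange_self, mul_one]
  | succ k hk ih =>
    rw [stepUpRange_succ W hk, stepUpRange_succ W (hil.trans hk), ← mul_assoc, ih]

theorem stepUpProd_eq (k : ℕ) : stepUpProd W k = stepUpRange W 0 k := by
  unfold stepUpProd stepUpRange
  simp

/-- The matrix `M^(k) = ∑ i ≤ k, M_{ki} * (𝓜_i * ⋯ * 𝓜_{k-1})`. -/
noncomputable def levelReturn (k : ℕ) : Matrix ι ι ℝ≥0∞ :=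
  ∑ i : Fin (k + 1), W k i * stepUpRange W i k

theorem stepUp_mulVec (k : ℕ) (v : ι → ℝ≥0∞) (p : ι) :
    (stepUp W k).mulVec v p =
      ∑' n, (levelReturn W k ^ n).mulVec ((W k (k + 1)).mulVec v) p := by
  rw [stepUp]
  simp only [Matrix.mulVec_mulVec]
  simp only [Matrix.mulVec, dotProduct, Matrix.of_apply]
  simp_rw [← ENNReal.tsum_mul_right]
  rw [← Summable.tsum_finsetSum fun _ _ => ENNReal.summable]
  rfl

theorem stepUp_mulVec_eq (k : ℕ) (v : ι → ℝ≥0∞) :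
    (stepUp W k).mulVec v =
      (W k (k + 1)).mulVec v + (levelReturn W k).mulVec ((stepUp W k).mulVec v) := by
  funext p
  have h : (stepUp W k).mulVec v = fun p =>
      ∑' n, (levelReturn W k ^ n).mulVec ((W k (k + 1)).mulVec v) p :=
    funext (stepUp_mulVec W k v)
  rw [Pi.add_apply]
  conv_rhs => rw [h, mulVec_tsum]
  rw [stepUp_mulVec, tsum_eq_zero_add' ENNReal.summable]
  simp [pow_succ', Matrix.mulVec_mulVec, mul_assoc]

/-- With `stepUp_mulVec_eq`, this makes the step-up vector the least solution of a linear equation.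
Minimality replaces inverting `1 - M^(k)`, which is impossible with infinite entries. -/
theorem stepUp_mulVec_le {k : ℕ} {v w : ι → ℝ≥0∞}
    (h : (W k (k + 1)).mulVec v + (levelReturn W k).mulVec w ≤ w) :
    (stepUp W k).mulVec v ≤ w := by
  have key : ∀ N : ℕ, (fun p => ∑ n ∈ Finset.range N,
      (levelReturn W k ^ n).mulVec ((W k (k + 1)).mulVec v) p) ≤ w := by
    intro N
    induction N with
    | zero => intro p; simp
    | succ N ih =>
      refine le_trans ?_ h
      intro p
      have h2 := mulVec_mono (levelReturn W k) ih p
      simp only [Finset.sum_range_succ', Pi.add_apply]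
      rw [add_comm]
      refine add_le_add (by simp) (le_trans (le_of_eq ?_) h2)
      simp only [pow_succ', ← Matrix.mulVec_mulVec]
      conv_rhs => rw [Matrix.mulVec, dotProduct]
      simp_rw [Finset.mul_sum]
      rw [Finset.sum_comm]
      rfl
  intro p
  rw [stepUp_mulVec, ENNReal.tsum_eq_iSup_nat]
  exact iSup_le fun N => key N p

theorem levelReturn_mulVec (k : ℕ) (v : ι → ℝ≥0∞) (p : ι) :
    (levelReturn W k).mulVec v p =
      ∑ i : Fin (k + 1), (W k i).mulVec ((stepUpRange W i k).mulVec v) p := by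
  simp only [levelReturn, Matrix.mulVec_mulVec]
  rw [Matrix.sum_mulVec, Finset.sum_apply]

/-- A path from level 0 to level `k` visits every level between, and `𝓜_l` weighs the paths from
level `l` up to their first arrival in level `l + 1`. The argument avoids paths: it builds a
supersolution of the Poisson equation from the step-up products. -/
theorem green_le_stepUpProd_mul {U : ℕ × ι → ℕ × ι → ℝ≥0∞}
    (hU : ∀ k l p r, k + 1 < l → U (k, p) (l, r) = 0)
    (k : ℕ) (q r : ι) :
    green U (0, q) (k, r) ≤ ∑ p, stepUpProd (blocks U) k q p * green U (k, p) (k, r) := by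
  set g : ℕ → ι → ℝ≥0∞ := fun l p => green U (l, p) (k, r) with hg
  have hgeq : ∀ l p, g l p = matPow U 0 (l, p) (k, r) +
      (∑ i : Fin (l + 1), (blocks U l i).mulVec (g i) p +
        (blocks U l (l + 1)).mulVec (g (l + 1)) p) := by
    intro l p
    rw [← tsum_mul_eq_blocks hU]
    exact green_eq U _ _
  -- the Green function dominates the step-up products
  have hrange : ∀ l, (∀ m < l, (stepUp (blocks U) m).mulVec (g (m + 1)) ≤ g m) →
      ∀ i ≤ l, (stepUpRange (blocks U) i l).mulVec (g l) ≤ g i := by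
    intro l hl i hi
    induction l, hi using Nat.le_induction with
    | base => simp [stepUpRange_self]
    | succ l hil ih =>
      rw [stepUpRange_succ _ hil, ← Matrix.mulVec_mulVec]
      exact (mulVec_mono _ (hl l (Nat.lt_succ_self l))).trans
        (ih fun m hm => hl m (hm.trans (Nat.lt_succ_self l)))
  have hstep : ∀ l, (stepUp (blocks U) l).mulVec (g (l + 1)) ≤ g l := by
    intro l
    induction l using Nat.strong_induction_on with
    | _ l ih =>
      refine stepUp_mulVec_le _ fun p => ?_
      rw [hgeq l p, Pi.add_apply, add_comm, levelReturn_mulVec]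
      refine le_add_left (add_le_add (Finset.sum_le_sum fun i _ => ?_) le_rfl)
      exact mulVec_mono _ (hrange l ih i (Nat.lt_succ_iff.1 i.2)) p
  -- the step-up products give a supersolution
  set h : ℕ → ι → ℝ≥0∞ := fun l =>
    if l ≤ k then (stepUpRange (blocks U) l k).mulVec (g k) else g l with hh
  have hhg : ∀ l, h l ≤ g l := by
    intro l
    simp only [hh]
    split_ifs with hl
    · exact hrange k (fun m _ => hstep m) l hl
    · exact le_rfl
  have hsuper : ∀ x : ℕ × ι, matPow U 0 x (k, r) + ∑' y : ℕ × ι, U x y * h y.1 y.2 ≤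
      h x.1 x.2 := by
    rintro ⟨l, p⟩
    rcases lt_or_ge l k with hl | hl
    -- Below level `k` the row involves only levels up to `l + 1 ≤ k`, where `h` solves the equation
    -- exactly by the step-up recursion.
    · have hne : (l, p) ≠ (k, r) := fun e => hl.ne (congrArg Prod.fst e)
      rw [matPow_zero_ne _ hne, zero_add, tsum_mul_eq_blocks hU]
      have h1 : ∀ i ≤ k, h i = (stepUpRange (blocks U) i k).mulVec (g k) := fun i hi =>
        if_pos hi
      have h2 : h l = (stepUp (blocks U) l).mulVec (h (l + 1)) := by
        rw [h1 l hl.le, h1 (l + 1) hl, Matrix.mulVec_mulVec,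
          ← stepUpRange_mul _ (Nat.le_succ l) hl, stepUpRange_succ _ le_rfl, stepUpRange_self,
          one_mul]
      have h3 : ∀ i ≤ l, h i = (stepUpRange (blocks U) i l).mulVec (h l) := by
        intro i hi
        rw [h1 i (hi.trans hl.le), h1 l hl.le, Matrix.mulVec_mulVec,
          stepUpRange_mul _ hi hl.le]
      have h4 := congrFun (stepUp_mulVec_eq (blocks U) l (h (l + 1))) p
      rw [← h2, Pi.add_apply, levelReturn_mulVec, add_comm] at h4
      refine le_of_eq (Eq.trans ?_ h4.symm)
      congr 1
      exact Finset.sum_congr rfl fun i _ => by rw [← h3 i (Nat.lt_succ_iff.1 i.2)]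
    -- From level `k` on, `h` equals `g`; since `h ≤ g` everywhere, the Green equation gives the
    -- inequality.
    · have h1 : h l = g l := by
        rcases hl.eq_or_lt with rfl | hl
        · simp [hh, stepUpRange_self]
        · simp [hh, hl]
      change _ ≤ h l p
      rw [h1]
      refine le_trans ?_ (green_eq U (l, p) (k, r)).ge
      gcongr with y
      exact hhg y.1 y.2
  have := green_le_of_supersolution U (k, r) (fun x => h x.1 x.2) hsuper (0, q)
  refine this.trans (le_of_eq ?_)
  simp only [hh, zero_le, if_true, ← stepUpProd_eq]
  rfl

end StepUp

theorem matPow_equiv {ι κ : Type*} (e : ι ≃ κ) (U : κ → κ → ℝ≥0∞) (n : ℕ) (i j : ι) :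
    matPow (fun a b => U (e a) (e b)) n i j = matPow U n (e i) (e j) := by
  induction n generalizing i with
  | zero => by_cases h : i = j <;> simp [matPow, h]
  | succ n ih =>
    simp_rw [matPow_succ, ih]
    exact e.tsum_eq (fun l => U (e i) l * matPow U n l (e j))


/-! ### The expected number of children of sterile type -/

section ExpectedEscapes

variable {d : ℕ}

/-- The generated sigma algebra lies inside the pullback of the discrete one along the phase map. -/
theorem mem_iff_of_phase_eq {A : Set (Ty d)} (hA : MeasurableSet[phaseSigma d] A) {x y : Ty d}
    (h : x.2 = y.2) : x ∈ A ↔ y ∈ A := by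
  have hle : phaseSigma d ≤ MeasurableSpace.comap Prod.snd ⊤ := by
    refine MeasurableSpace.generateFrom_le ?_
    rintro _ ⟨i, rfl⟩
    exact ⟨{i}, trivial, rfl⟩
  obtain ⟨s, -, rfl⟩ := hle A hA
  simp [h]

/-- A set in `σ(A_1, …, A_d)` consists of all types with a phase that occurs in it. -/
def equivPhases {B : Set (Ty d)} (hB : MeasurableSet[phaseSigma d] B) : B ≃ ℕ × phases B where
  toFun x := (x.1.1, ⟨x.1.2, x.1, x.2, rfl⟩)
  invFun y := ⟨(y.1, y.2.1), by
    obtain ⟨k, p, x, hx, rfl⟩ := y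
    exact (mem_iff_of_phase_eq (x := x) (y := (k, x.2)) hB rfl).1 hx⟩
  left_inv _ := rfl
  right_inv _ := rfl

theorem meanMatrix_eq_zero (P : OffspringLaws d) {i j : Ty d} (h : i.1 + 1 < j.1) :
    meanMatrix P i j = 0 := by
  refine ENNReal.tsum_eq_zero.2 fun r => ?_
  by_cases hr : r ∈ (P.law i).support
  · simp [P.hessenberg i r hr j h]
  · rw [(PMF.apply_eq_zero_iff _ _).2 hr, zero_mul]

/-- The matrix `M̃^(B)` indexed by levels and phases. -/
noncomputable def phaseMatrix (P : OffspringLaws d) (B : Set (Ty d)) (x y : ℕ × phases B) :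
    ℝ≥0∞ :=
  meanMatrix P (x.1, x.2) (y.1, y.2)

theorem green_subMatrix (P : OffspringLaws d) {B : Set (Ty d)}
    (hB : MeasurableSet[phaseSigma d] B) (i j : B) :
    green (subMatrix P B) i j = green (phaseMatrix P B) (equivPhases hB i) (equivPhases hB j) :=
  tsum_congr fun n => matPow_equiv (equivPhases hB) (phaseMatrix P B) n i j

theorem green_le_of_level_eq {B : Set (Ty d)} {W : B → B → ℝ≥0∞} {ρ : ℝ≥0∞}
    (hν : convNorm W < ρ) {K : ℝ≥0}
    (hK : ∀ k : ℕ, ∀ i j : B, i.1.1 = k → j.1.1 = k → firstPassageSum W i j ≤ K)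
    {i j : B} (hij : i.1.1 = j.1.1) : green W i j ≤ K * (1 - ρ)⁻¹ :=
  (green_le_firstPassageSum_mul W i j).trans
    (mul_le_mul' (hK _ i j hij rfl) (green_self_le W hν j))

theorem tsum_green_mul_lt_top {P : OffspringLaws d} {A : Set (Ty d)}
    (hA : MeasurableSet[phaseSigma d] A)
    (hnu : convNorm (subMatrix P Aᶜ) < 1)
    (hcondA : ∀ p : phases Aᶜ, ∑' k : ℕ, (∑ r, tVec P A k r) *
      (Matrix.mulVec (stepUpProd (subBlock P Aᶜ) k) 1) p < ∞)
    (hcondB : ∃ K : ℝ≥0, ∀ k : ℕ, ∀ i j : ↥(Aᶜ), i.1.1 = k → j.1.1 = k →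
      firstPassageSum (subMatrix P Aᶜ) i j ≤ K)
    (i : ↥Aᶜ) (hi : i.1.1 = 0) :
    ∑' j : ↥Aᶜ, green (subMatrix P Aᶜ) i j * ∑' a : A, meanMatrix P j a < ∞ := by
  obtain ⟨ρ, hρ, hρ1⟩ := exists_between hnu
  obtain ⟨K, hK⟩ := hcondB
  set C : ℝ≥0∞ := K * (1 - ρ)⁻¹ with hC
  have hCtop : C ≠ ∞ :=
    ENNReal.mul_ne_top ENNReal.coe_ne_top (ENNReal.inv_ne_top.2 (tsub_pos_of_lt hρ1).ne')
  set e := equivPhases hA.compl with he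
  set q : phases Aᶜ := (e i).2 with hq
  have hei : e i = (0, q) := Prod.ext hi rfl
  have hbl : subBlock P Aᶜ = blocks (phaseMatrix P Aᶜ) := rfl
  have hG : ∀ k (p' p : phases Aᶜ), green (phaseMatrix P Aᶜ) (k, p') (k, p) ≤ C := by
    intro k p' p
    have := green_subMatrix P hA.compl (e.symm (k, p')) (e.symm (k, p))
    rw [← he, e.apply_symm_apply, e.apply_symm_apply] at this
    rw [← this]
    exact green_le_of_level_eq hρ hK rfl
  calc ∑' j : ↥Aᶜ, green (subMatrix P Aᶜ) i j * ∑' a : A, meanMatrix P j a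
      = ∑' x : ℕ × phases Aᶜ, green (phaseMatrix P Aᶜ) (0, q) x * tVec P A x.1 x.2 := by
        rw [← e.tsum_eq fun x : ℕ × phases Aᶜ =>
          green (phaseMatrix P Aᶜ) (0, q) x * tVec P A x.1 x.2]
        refine tsum_congr fun j => ?_
        rw [green_subMatrix P hA.compl, ← he, hei]
        rfl
    _ = ∑' k, ∑ p, green (phaseMatrix P Aᶜ) (0, q) (k, p) * tVec P A k p := by
        rw [ENNReal.tsum_prod']
        simp_rw [tsum_fintype]
    _ ≤ ∑' k, C * ((∑ r, tVec P A k r) *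
          (Matrix.mulVec (stepUpProd (subBlock P Aᶜ) k) 1) q) := by
        refine ENNReal.tsum_le_tsum fun k => ?_
        rw [mul_left_comm, Finset.sum_mul]
        refine Finset.sum_le_sum fun p _ => ?_
        rw [mul_comm]
        gcongr
        -- The bound on the Green function does not depend on the phase `p`, so the entries of `t_k`
        -- are simply added, as in (A).
        refine (green_le_stepUpProd_mul (U := phaseMatrix P Aᶜ)
          (fun k l p r h => meanMatrix_eq_zero P h) k q p).trans ?_
        rw [Matrix.mulVec, dotProduct, Finset.mul_sum, hbl]
        refine Finset.sum_le_sum fun p' _ => ?_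
        rw [Pi.one_apply, mul_one, mul_comm]
        gcongr
        exact hG k p' p
    _ < ∞ := by
        rw [ENNReal.tsum_mul_left]
        exact ENNReal.mul_lt_top hCtop.lt_top (hcondA q)

end ExpectedEscapes

/-! ### Family trees -/

section Trees

variable {d : ℕ}

/-- The offspring vectors of the descendants of one individual. -/
abbrev Tree (d : ℕ) : Type := List (Ty d × ℕ) → Offspring d

/-- The law of the tree that descends from an individual of type `φ`. -/
noncomputable def treeProb (P : OffspringLaws d) (φ : Ty d) : Measure (Tree d) :=
  Measure.infinitePi fun I => (P.law (typeOf (φ, I))).toMeasure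

instance instIsProbabilityMeasureTreeProb (P : OffspringLaws d) (φ : Ty d) :
    IsProbabilityMeasure (treeProb P φ) := by
  unfold treeProb; infer_instance

/-- The individual `I` appears in the tree. -/
def Born (t : Tree d) : List (Ty d × ℕ) → Prop
  | [] => True
  | (l, m) :: I => Born t I ∧ m < t I l

theorem appears_iff (ω : Sample d) (φ : Ty d) (I : List (Ty d × ℕ)) :
    Appears ω φ I ↔ Born (fun J => ω (φ, J)) I := by
  induction I with
  | nil => simp [Appears, Born]
  | cons a I ih => obtain ⟨l, m⟩ := a; simp [Appears, Born, ih]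

open scoped Classical in
/-- The tree with root type `φ` in which the types outside `B` are sterile. -/
noncomputable def restrictTo (B : Set (Ty d)) (φ : Ty d) (t : Tree d) : Tree d :=
  fun I => if typeOf (φ, I) ∈ B then t I else 0

/-- The trees in which the types in `A` become extinct. -/
def treeExtinct (φ : Ty d) (A : Set (Ty d)) : Set (Tree d) :=
  {t | ∃ n, ∀ I, n ≤ I.length → typeOf (φ, I) ∈ A → ¬ Born t I}

theorem mem_extinct_iff (ω : Sample d) (φ : Ty d) (A : Set (Ty d)) :
    ω ∈ extinct φ A ↔ (fun J => ω (φ, J)) ∈ treeExtinct φ A := by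
  simp only [extinct, extinctFrom, treeExtinct, mem_iUnion, mem_ofPred_eq, Z,
    Set.encard_eq_zero, Set.eq_empty_iff_forall_notMem, not_and, appears_iff]
  refine exists_congr fun n => ⟨fun h I hn hI hb => ?_, fun h l hl i hi I hIl hb hti => ?_⟩
  · exact h _ hn _ hI I rfl hb rfl
  · exact h I (hIl ▸ hl) (hti ▸ hi) hb

theorem typeOf_cons (φ l : Ty d) (m : ℕ) (I : List (Ty d × ℕ)) :
    typeOf (φ, (l, m) :: I) = l := rfl

theorem typeOf_append (φ : Ty d) (L I : List (Ty d × ℕ)) :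
    typeOf (φ, L ++ I) = typeOf (typeOf (φ, I), L) := by
  cases L <;> rfl

/-- The subtree that descends from the individual `I`. -/
def subtree (I : List (Ty d × ℕ)) (t : Tree d) : Tree d := fun L => t (L ++ I)

theorem born_append (t : Tree d) (L I : List (Ty d × ℕ)) :
    Born t (L ++ I) ↔ Born t I ∧ Born (subtree I t) L := by
  induction L with
  | nil => simp [Born]
  | cons a L ih => obtain ⟨l, m⟩ := a; simp [Born, ih, and_assoc, subtree]

theorem subtree_restrictTo (B : Set (Ty d)) (φ : Ty d) (t : Tree d) (I : List (Ty d × ℕ)) :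
    subtree I (restrictTo B φ t) = restrictTo B (typeOf (φ, I)) (subtree I t) := by
  funext L
  simp only [subtree, restrictTo]
  rw [typeOf_append]

theorem restrictTo_univ (φ : Ty d) (t : Tree d) : restrictTo univ φ t = t := by
  funext L
  simp [restrictTo]

/-- This holds for every tree, not just almost surely, because offspring vectors have finite
support. -/
theorem finite_born (t : Tree d) (n : ℕ) : {I | I.length = n ∧ Born t I}.Finite := by
  induction n with
  | zero => exact (finite_singleton []).subset fun I hI => List.length_eq_zero_iff.1 hI.1
  | succ n ih =>
    have h : ∀ I, {a : Ty d × ℕ | a.2 < t I a.1}.Finite := by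
      intro I
      refine ((t I).support.finite_toSet.biUnion
        fun l _ => (finite_lt_nat (t I l)).image fun m => (l, m)).subset ?_
      rintro ⟨l, m⟩ hm
      simp only [mem_iUnion]
      refine ⟨l, ?_, m, hm, rfl⟩
      have : m < t I l := hm
      simp only [Finset.mem_coe, Finsupp.mem_support_iff]
      omega
    refine (ih.biUnion fun I _ => (h I).image fun a => a :: I).subset ?_
    rintro (_ | ⟨a, I⟩) ⟨hl, hb⟩
    · simp at hl
    · simp only [mem_iUnion]
      exact ⟨I, ⟨by simpa using hl, hb.1⟩, a, hb.2, rfl⟩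

theorem eq_nil_of_born {t : Tree d} (ht : t [] = 0) {I : List (Ty d × ℕ)} (h : Born t I) :
    I = [] := by
  induction I with
  | nil => rfl
  | cons a I ih =>
    obtain ⟨l, m⟩ := a
    obtain ⟨h1, h2⟩ := h
    rw [ih h1, ht] at h2
    exact absurd h2 (Nat.not_lt_zero m)

/-! ### Measurability -/

/-- The sigma algebra generated by the offspring vectors of the individuals in `S`. -/
@[reducible]
def sigmaOf (S : Set (List (Ty d × ℕ))) : MeasurableSpace (Tree d) :=
  ⨆ I ∈ S, MeasurableSpace.comap (fun t => t I) ⊤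

theorem sigmaOf_le (S : Set (List (Ty d × ℕ))) : sigmaOf S ≤ MeasurableSpace.pi :=
  iSup₂_le fun I _ => (measurable_pi_apply I).comap_le

theorem sigmaOf_mono {S T : Set (List (Ty d × ℕ))} (h : S ⊆ T) : sigmaOf S ≤ sigmaOf T :=
  biSup_mono h

theorem measurableSet_sigmaOf {S : Set (List (Ty d × ℕ))} {I : List (Ty d × ℕ)} (hI : I ∈ S)
    (p : Offspring d → Prop) : MeasurableSet[sigmaOf S] {t : Tree d | p (t I)} :=
  (le_iSup₂ (f := fun (J : List (Ty d × ℕ)) (_ : J ∈ S) =>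
    MeasurableSpace.comap (fun t : Tree d => t J) ⊤) I hI) _ ⟨{r | p r}, trivial, rfl⟩

/-- A birth is decided by the offspring vectors of the strict ancestors, all in earlier generations.
-/
theorem measurableSet_born_restrictTo_sigmaOf (B : Set (Ty d)) (φ : Ty d)
    (I : List (Ty d × ℕ)) {n : ℕ} (hn : I.length ≤ n) :
    MeasurableSet[sigmaOf {J | J.length < n}] {t | Born (restrictTo B φ t) I} := by
  induction I with
  | nil => simp [Born]
  | cons a I ih =>
    obtain ⟨l, m⟩ := a
    simp only [List.length_cons] at hn
    have h1 := measurableSet_sigmaOf (S := {J : List (Ty d × ℕ) | J.length < n}) (I := I)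
      (show I.length < n by omega) (fun r => typeOf (φ, I) ∈ B ∧ m < r l)
    have h2 : {t | Born (restrictTo B φ t) ((l, m) :: I)} = {t | Born (restrictTo B φ t) I} ∩
        {t | typeOf (φ, I) ∈ B ∧ m < t I l} := by
      ext t
      by_cases h : typeOf (φ, I) ∈ B <;> simp [Born, restrictTo, h]
    rw [h2]
    exact MeasurableSet.inter (ih (by omega)) h1

theorem measurableSet_born_sigmaOf (I : List (Ty d × ℕ)) {n : ℕ} (hn : I.length ≤ n) (φ : Ty d) :
    MeasurableSet[sigmaOf {J | J.length < n}] {t | Born t I} := by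
  simpa only [restrictTo_univ] using measurableSet_born_restrictTo_sigmaOf univ φ I hn

theorem measurableSet_born (I : List (Ty d × ℕ)) : MeasurableSet {t : Tree d | Born t I} := by
  cases I with
  | nil => simp [Born]
  | cons a I => exact sigmaOf_le _ _ (measurableSet_born_sigmaOf (a :: I) le_rfl a.1)

theorem measurable_restrictTo (B : Set (Ty d)) (φ : Ty d) : Measurable (restrictTo B φ) := by
  refine measurable_pi_iff.2 fun I => ?_
  by_cases h : typeOf (φ, I) ∈ B
  · simpa [restrictTo, h] using measurable_pi_apply I
  · simp [restrictTo, h]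

theorem measurableSet_not_born (φ : Ty d) (A : Set (Ty d)) (n : ℕ) :
    MeasurableSet {t : Tree d | ∀ I, n ≤ I.length → typeOf (φ, I) ∈ A → ¬ Born t I} := by
  simp only [ofPred_forall]
  exact MeasurableSet.iInter fun I => MeasurableSet.iInter fun _ => MeasurableSet.iInter fun _ =>
    (measurableSet_born I).compl

theorem measurableSet_treeExtinct (φ : Ty d) (A : Set (Ty d)) :
    MeasurableSet (treeExtinct φ A) := by
  simp only [treeExtinct, ofPred_exists]
  exact MeasurableSet.iUnion fun n => measurableSet_not_born φ A n

/-! ### Laws of trees and subtrees -/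

variable (P : OffspringLaws d)

theorem map_prob (φ : Ty d) :
    (prob P).map (fun ω I => ω (φ, I)) = treeProb P φ :=
  Measure.map_infinitePi_infinitePi_of_inj
    (P := fun I : Label d => (P.law (typeOf I)).toMeasure) (f := fun I => (φ, I))
    fun _ _ h => (Prod.mk.inj h).2

theorem prob_eq_treeProb (φ : Ty d) {s : Set (Tree d)} (hs : MeasurableSet s) :
    prob P {ω | (fun I => ω (φ, I)) ∈ s} = treeProb P φ s := by
  rw [← map_prob, Measure.map_apply (by fun_prop) hs]
  rfl

theorem qSet_eq (A : Set (Ty d)) (φ : Ty d) : qSet P A φ = treeProb P φ (treeExtinct φ A) := by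
  rw [← prob_eq_treeProb P φ (measurableSet_treeExtinct φ A), qSet]
  congr 1
  ext ω
  exact mem_extinct_iff ω φ A

theorem qPartial_eq (φ : Ty d) :
    qPartial P φ = treeProb P φ (⋂ k, treeExtinct φ (upToLevel d k)) := by
  rw [← prob_eq_treeProb P φ (MeasurableSet.iInter fun k => measurableSet_treeExtinct φ _),
    qPartial]
  congr 1
  ext ω
  simp [mem_extinct_iff]

theorem measurableSet_restrictTo_extinct (B A : Set (Ty d)) (φ : Ty d) :
    MeasurableSet {t | restrictTo B φ t ∈ treeExtinct φ A} :=
  measurable_restrictTo B φ (measurableSet_treeExtinct φ A)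

theorem qSterile_eq (B : Set (Ty d)) (φ : Ty d) :
    qSterile P B φ = treeProb P φ {t | restrictTo B φ t ∈ treeExtinct φ univ} := by
  rw [← prob_eq_treeProb P φ (measurableSet_restrictTo_extinct B univ φ), qSterile]
  congr 1
  ext ω
  exact mem_extinct_iff (sterilize B ω) φ univ

theorem measurable_subtree (I : List (Ty d × ℕ)) : Measurable (subtree (d := d) I) :=
  measurable_pi_iff.2 fun L => measurable_pi_apply (L ++ I)

/-- Branching property: lists carry the newest generation at the head, so the descendants of `I` are
the `L ++ I`, and the subtree is a product measure read along an injection. -/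
theorem map_subtree (φ : Ty d) (I : List (Ty d × ℕ)) :
    (treeProb P φ).map (subtree I) = treeProb P (typeOf (φ, I)) := by
  have h := Measure.map_infinitePi_infinitePi_of_inj
    (P := fun L => (P.law (typeOf (φ, L))).toMeasure) (f := fun L => L ++ I)
    (List.append_left_injective I)
  simp only [typeOf_append] at h
  exact h

theorem treeProb_subtree (φ : Ty d) (I : List (Ty d × ℕ)) {s : Set (Tree d)}
    (hs : MeasurableSet s) :
    treeProb P φ (subtree I ⁻¹' s) = treeProb P (typeOf (φ, I)) s := by
  rw [← map_subtree, Measure.map_apply (measurable_subtree I) hs]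

theorem indep_sigmaOf (φ : Ty d) {S T : Set (List (Ty d × ℕ))} (h : Disjoint S T) :
    ProbabilityTheory.Indep (sigmaOf S) (sigmaOf T) (treeProb P φ) :=
  ProbabilityTheory.indep_iSup_of_disjoint (fun I => (measurable_pi_apply I).comap_le)
    (ProbabilityTheory.iIndepFun_infinitePi
      (P := fun I => (P.law (typeOf (φ, I))).toMeasure) (X := fun _ r => r)
      fun _ => measurable_id) h

/-! ### Expected generation sizes -/

theorem tsum_toMeasure_lt (p : PMF (Offspring d)) (l : Ty d) :
    ∑' m : ℕ, p.toMeasure {r | m < r l} = ∑' r, p r * (r l : ℝ≥0∞) := by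
  have h : ∀ m : ℕ, p.toMeasure {r | m < r l} = ∑' r, if m < r l then p r else 0 := by
    intro m
    rw [PMF.toMeasure_apply _ MeasurableSet.of_discrete]
    refine tsum_congr fun r => ?_
    by_cases hr : m < r l <;> simp [Set.indicator, hr]
  simp_rw [h]
  rw [ENNReal.tsum_comm]
  refine tsum_congr fun r => ?_
  rw [tsum_eq_sum (s := Finset.range (r l)) fun m hm => if_neg (by simpa using hm),
    Finset.sum_congr rfl fun m hm => if_pos (by simpa using hm)]
  simp [mul_comm]

theorem treeProb_born_cons {B : Set (Ty d)} {φ : Ty d} {I : List (Ty d × ℕ)}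
    (hI : typeOf (φ, I) ∈ B) (l : Ty d) (m : ℕ) :
    treeProb P φ {t | Born (restrictTo B φ t) ((l, m) :: I)} =
      treeProb P φ {t | Born (restrictTo B φ t) I} *
        (P.law (typeOf (φ, I))).toMeasure {r | m < r l} := by
  have h1 : {t | Born (restrictTo B φ t) ((l, m) :: I)} =
      {t | Born (restrictTo B φ t) I} ∩ {t | m < t I l} := by
    ext t
    simp [Born, restrictTo, hI]
  have hd : Disjoint {J : List (Ty d × ℕ) | J.length < I.length} {I} := by simp
  rw [h1, (ProbabilityTheory.Indep_iff _ _ _).1 (indep_sigmaOf P φ hd) _ _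
    (measurableSet_born_restrictTo_sigmaOf B φ I le_rfl)
    (measurableSet_sigmaOf (mem_singleton I) fun r => m < r l)]
  congr 1
  rw [← Measure.infinitePi_map_eval (fun I => (P.law (typeOf (φ, I))).toMeasure) I,
    Measure.map_apply (measurable_pi_apply I) MeasurableSet.of_discrete]
  rfl

theorem tsum_list {α : Type*} (f : List α → ℝ≥0∞) :
    ∑' I, f I = f [] + ∑' a, ∑' I, f (a :: I) := by
  rw [tsum_eq_add_tsum_ne [] f]
  congr 1
  let e : α × List α ≃ {I : List α // I ≠ []} :=
    { toFun := fun x => ⟨x.1 :: x.2, by simp⟩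
      invFun := fun I => (I.1.head I.2, I.1.tail)
      left_inv := fun x => rfl
      right_inv := fun I => Subtype.ext (List.cons_head_tail I.2) }
  rw [← e.tsum_eq, ENNReal.tsum_prod']
  rfl

open scoped Classical in
/-- The expected number of individuals of type `j` in generation `n` of the process in which the
types outside `B` are sterile. -/
noncomputable def meanCount (B : Set (Ty d)) (φ : Ty d) (n : ℕ) (j : Ty d) : ℝ≥0∞ :=
  ∑' I, if I.length = n ∧ typeOf (φ, I) = j then
    treeProb P φ {t | Born (restrictTo B φ t) I} else 0

theorem meanCount_zero (B : Set (Ty d)) (φ j : Ty d) :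
    meanCount P B φ 0 j = if φ = j then 1 else 0 := by
  classical
  rw [meanCount, tsum_list]
  simp [typeOf, Born]

/-- The parent's birth is independent of its own offspring vector, and summing tail probabilities
over the child's number gives the mean. Only parents are confined to `B`; `l` may be sterile. -/
theorem meanCount_succ (B : Set (Ty d)) (φ : Ty d) (n : ℕ) (l : Ty d) :
    meanCount P B φ (n + 1) l = ∑' j : B, meanCount P B φ n j * meanMatrix P j l := by
  classical
  have hR : ∑' j : B, meanCount P B φ n j * meanMatrix P j l =
      ∑' I : List (Ty d × ℕ), if I.length = n ∧ typeOf (φ, I) ∈ B then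
        treeProb P φ {t | Born (restrictTo B φ t) I} * meanMatrix P (typeOf (φ, I)) l else 0 := by
    unfold meanCount
    simp_rw [← ENNReal.tsum_mul_right]
    rw [ENNReal.tsum_comm]
    refine tsum_congr fun I => ?_
    by_cases hB : typeOf (φ, I) ∈ B
    · rw [tsum_eq_single (⟨typeOf (φ, I), hB⟩ : B)]
      · simp [hB]
      · intro j hj
        rw [if_neg, zero_mul]
        rintro ⟨-, h⟩
        exact hj (Subtype.ext h.symm)
    · rw [if_neg fun h => hB h.2]
      refine ENNReal.tsum_eq_zero.2 fun j => ?_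
      rw [if_neg, zero_mul]
      rintro ⟨-, h⟩
      exact hB (h ▸ j.2)
  rw [hR, meanCount, tsum_list, if_neg (by simp), zero_add, ENNReal.tsum_comm]
  refine tsum_congr fun I => ?_
  rw [ENNReal.tsum_prod', tsum_eq_single l]
  · by_cases hn : I.length = n
    · by_cases hB : typeOf (φ, I) ∈ B
      · simp only [List.length_cons, hn, typeOf_cons, hB, and_self, if_true]
        simp_rw [treeProb_born_cons P hB]
        rw [ENNReal.tsum_mul_left, tsum_toMeasure_lt, meanMatrix]
      · rw [if_neg fun h => hB h.2]
        refine ENNReal.tsum_eq_zero.2 fun m => ?_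
        simp [Born, restrictTo, hB]
    · simp [hn]
  · intro l' hl'
    simp [typeOf_cons, hl']

theorem meanCount_eq_matPow {B : Set (Ty d)} (n : ℕ) (i j : B) :
    meanCount P B i n j = matPow (subMatrix P B) n i j := by
  induction n generalizing j with
  | zero => rw [meanCount_zero, matPow]; simp [Subtype.ext_iff]
  | succ n ih =>
    rw [meanCount_succ, matPow_succ_right]
    simp_rw [ih]
    rfl

theorem tsum_tsum_meanCount (B A : Set (Ty d)) (φ : Ty d) [DecidablePred (· ∈ A)] :
    ∑' n, ∑' a : A, meanCount P B φ n a =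
      ∑' I, if typeOf (φ, I) ∈ A then treeProb P φ {t | Born (restrictTo B φ t) I} else 0 := by
  classical
  unfold meanCount
  simp_rw [ENNReal.tsum_comm (α := A)]
  rw [ENNReal.tsum_comm]
  refine tsum_congr fun I => ?_
  rw [tsum_eq_single I.length]
  · by_cases h : typeOf (φ, I) ∈ A
    · rw [tsum_eq_single (⟨typeOf (φ, I), h⟩ : A)]
      · simp [h]
      · intro j hj
        rw [if_neg]
        rintro ⟨-, h⟩
        exact hj (Subtype.ext h.symm)
    · rw [if_neg h]
      refine ENNReal.tsum_eq_zero.2 fun j => if_neg ?_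
      rintro ⟨-, h'⟩
      exact h (h' ▸ j.2)
  · intro n hn
    simp [hn.symm]

end Trees

section Escape

variable {d : ℕ}

/-! ### Survival without individuals of sterile type -/

/-- The trees with root type `φ` that survive, when the types outside `B` are sterile, and have
no individual of sterile type. -/
def survivesWithin (φ : Ty d) (B : Set (Ty d)) : Set (Tree d) :=
  {t | restrictTo B φ t ∉ treeExtinct φ univ ∧
    ∀ I, Born (restrictTo B φ t) I → typeOf (φ, I) ∈ B}

theorem measurableSet_survivesWithin (φ : Ty d) (B : Set (Ty d)) :
    MeasurableSet (survivesWithin φ B) := by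
  have h : survivesWithin φ B = {t | restrictTo B φ t ∈ treeExtinct φ univ}ᶜ ∩
      ⋂ I, {t | Born (restrictTo B φ t) I → typeOf (φ, I) ∈ B} := by
    ext t
    simp [survivesWithin]
  rw [h]
  refine MeasurableSet.inter (measurableSet_restrictTo_extinct B univ φ).compl
    (MeasurableSet.iInter fun I => ?_)
  by_cases h : typeOf (φ, I) ∈ B
  · simp [h]
  · simp only [h, imp_false]
    exact (measurable_restrictTo B φ (measurableSet_born I)).compl

theorem born_iff_of_forall_mem {φ : Ty d} {B : Set (Ty d)} {t : Tree d}
    (h : ∀ I, Born (restrictTo B φ t) I → typeOf (φ, I) ∈ B) (I : List (Ty d × ℕ)) :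
    Born (restrictTo B φ t) I ↔ Born t I := by
  induction I with
  | nil => simp [Born]
  | cons a I ih =>
    obtain ⟨l, m⟩ := a
    simp only [Born, ← ih]
    refine and_congr_right fun hb => ?_
    simp [restrictTo, h I hb]

theorem treeExtinct_iff_of_mem_survivesWithin {φ : Ty d} {B : Set (Ty d)} {t : Tree d}
    (ht : t ∈ survivesWithin φ B) (A : Set (Ty d)) :
    restrictTo B φ t ∈ treeExtinct φ A ↔ t ∈ treeExtinct φ A := by
  simp only [treeExtinct, mem_ofPred_eq, born_iff_of_forall_mem ht.2]

/-- In a surviving population some individual of each generation has surviving descendants. -/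
theorem exists_born_subtree_notMem_treeExtinct {φ : Ty d} {t : Tree d}
    (ht : t ∉ treeExtinct φ univ) (n : ℕ) :
    ∃ J, J.length = n ∧ Born t J ∧ subtree J t ∉ treeExtinct (typeOf (φ, J)) univ := by
  by_contra! hcon
  have h1 : ∀ᶠ m in atTop, ∀ J ∈ {J | J.length = n ∧ Born t J},
      ∀ L : List (Ty d × ℕ), m ≤ L.length → ¬ Born (subtree J t) L := by
    refine (eventually_all_finite (finite_born t n)).2 fun J hJ => ?_
    obtain ⟨m, hm⟩ := hcon J hJ.1 hJ.2
    filter_upwards [eventually_ge_atTop m] with m' hm' L hL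
    exact hm L (hm'.trans hL) (mem_univ _)
  obtain ⟨m, hm⟩ := h1.exists
  refine ht ⟨m + n, fun I hI _ hb => ?_⟩
  rw [← List.take_append_drop (I.length - n) I, born_append] at hb
  refine hm (I.drop (I.length - n)) ⟨?_, hb.1⟩ (I.take (I.length - n)) ?_ hb.2
  · rw [List.length_drop]; omega
  · rw [List.length_take]; omega

/-- Some individual of generation `n` has a surviving line; either it is outside `B`, or its
subtree, surviving but not within `B`, contains such an individual. -/
theorem exists_born_notMem_of_forall_subtree {φ : Ty d} {B : Set (Ty d)} {t : Tree d}
    (ht : restrictTo B φ t ∉ treeExtinct φ univ)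
    (hsub : ∀ I, typeOf (φ, I) ∈ B → subtree I t ∉ survivesWithin (typeOf (φ, I)) B) (n : ℕ) :
    ∃ I, n ≤ I.length ∧ Born (restrictTo B φ t) I ∧ typeOf (φ, I) ∉ B := by
  obtain ⟨J, hJn, hJ, hJs⟩ := exists_born_subtree_notMem_treeExtinct ht n
  by_cases hB : typeOf (φ, J) ∈ B
  · rw [subtree_restrictTo] at hJs
    have h := hsub J hB
    simp only [survivesWithin, mem_ofPred_eq, not_and, not_forall] at h
    obtain ⟨L, hL, hLB⟩ := h hJs
    refine ⟨L ++ J, by simp [hJn], (born_append _ L J).2 ⟨hJ, ?_⟩, ?_⟩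
    · rwa [subtree_restrictTo]
    · rwa [typeOf_append]
  · exact ⟨J, hJn.ge, hJ, hB⟩

variable (P : OffspringLaws d)

/-- The hypothesis bounds the expected number of sterile births, so Borel–Cantelli over the
individuals applies. -/
theorem ae_finite_escapes {A : Set (Ty d)} (i : ↥Aᶜ)
    (h : ∑' j : ↥Aᶜ, green (subMatrix P Aᶜ) i j * ∑' a : A, meanMatrix P j a < ∞) :
    ∀ᵐ t ∂treeProb P i,
      {I | typeOf (i.1, I) ∈ A ∧ Born (restrictTo Aᶜ i t) I}.Finite := by
  classical
  have hsum : ∑' n, ∑' a : A, meanCount P Aᶜ i n a =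
      ∑' j : ↥Aᶜ, green (subMatrix P Aᶜ) i j * ∑' a : A, meanMatrix P j a := by
    rw [tsum_eq_zero_add' ENNReal.summable]
    have h0 : ∑' a : A, meanCount P Aᶜ i 0 a = 0 := by
      refine ENNReal.tsum_eq_zero.2 fun a => ?_
      rw [meanCount_zero, if_neg]
      intro h
      exact i.2 (h ▸ a.2)
    simp_rw [h0, zero_add, meanCount_succ, meanCount_eq_matPow, green]
    simp_rw [← ENNReal.tsum_mul_right, ← ENNReal.tsum_mul_left]
    simp_rw [ENNReal.tsum_comm (α := A)]
    rw [ENNReal.tsum_comm]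
  rw [← hsum, tsum_tsum_meanCount] at h
  have h2 : ∑' I, treeProb P i
      {t | typeOf (i.1, I) ∈ A ∧ Born (restrictTo Aᶜ i t) I} ≠ ∞ := by
    refine ne_of_lt (lt_of_le_of_lt (ENNReal.tsum_le_tsum fun I => ?_) h)
    by_cases hI : typeOf (i.1, I) ∈ A <;> simp [hI]
  exact ae_finite_setOfPred_mem h2

theorem exists_treeProb_survivesWithin_pos {A : Set (Ty d)} (i : ↥Aᶜ)
    (h : ∑' j : ↥Aᶜ, green (subMatrix P Aᶜ) i j * ∑' a : A, meanMatrix P j a < ∞)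
    (hi : qSterile P Aᶜ i < 1) :
    ∃ j ∈ Aᶜ, 0 < treeProb P j (survivesWithin j Aᶜ) := by
  by_contra! hcon
  have hae : ∀ᵐ t ∂treeProb P i, ∀ I, typeOf (i.1, I) ∈ Aᶜ →
      subtree I t ∉ survivesWithin (typeOf (i.1, I)) Aᶜ := by
    rw [ae_all_iff]
    intro I
    by_cases hI : typeOf (i.1, I) ∈ Aᶜ
    · have h0 := treeProb_subtree P i I
        (measurableSet_survivesWithin (typeOf (i.1, I)) Aᶜ)
      rw [nonpos_iff_eq_zero.1 (hcon _ hI)] at h0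
      filter_upwards [measure_eq_zero_iff_ae_notMem.1 h0] with t ht _
      exact ht
    · exact ae_of_all _ fun t h => absurd h hI
  have hext : ∀ᵐ t ∂treeProb P i, restrictTo Aᶜ i t ∈ treeExtinct i.1 univ := by
    filter_upwards [hae, ae_finite_escapes P i h] with t ht hfin
    by_contra hs
    obtain ⟨N, hN⟩ := (hfin.image List.length).bddAbove
    obtain ⟨I, hI, hb, hA⟩ := exists_born_notMem_of_forall_subtree hs ht (N + 1)
    have : I.length ≤ N := hN ⟨I, ⟨not_not.1 hA, hb⟩, rfl⟩
    omega
  rw [qSterile_eq] at hi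
  exact hi.ne ((prob_compl_eq_zero_iff
    (measurableSet_restrictTo_extinct Aᶜ univ i.1)).1 hext)

/-! ### Partial extinction -/

theorem finite_upToLevel (k : ℕ) : (upToLevel d k).Finite := by
  refine ((finite_le_nat k).prod (finite_univ (α := Fin d))).subset ?_
  rintro ⟨l, p⟩ h
  exact ⟨h, mem_univ _⟩

theorem mem_treeExtinct_of_finite {φ : Ty d} {t : Tree d} {S : Set (Ty d)} (hS : S.Finite)
    (h : ∀ j ∈ S, t ∈ treeExtinct φ {j}) : t ∈ treeExtinct φ S := by
  have h1 : ∀ᶠ n in atTop, ∀ j ∈ S, ∀ I : List (Ty d × ℕ), n ≤ I.length →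
      typeOf (φ, I) = j → ¬ Born t I := by
    refine (eventually_all_finite hS).2 fun j hj => ?_
    obtain ⟨n, hn⟩ := h j hj
    filter_upwards [eventually_ge_atTop n] with m hm I hI
    exact hn I (hm.trans hI)
  obtain ⟨n, hn⟩ := h1.exists
  exact ⟨n, fun I hI hIS => hn _ hIS I hI rfl⟩

theorem ae_restrictTo_mem_treeExtinct_singleton {B : Set (Ty d)}
    (hnu : convNorm (subMatrix P B) < 1) (i j : B) :
    ∀ᵐ t ∂treeProb P i, restrictTo B i t ∈ treeExtinct i.1 {j.1} := by
  classical
  obtain ⟨ρ, hρ, hρ1⟩ := exists_between hnu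
  obtain ⟨N, hN⟩ := eventually_atTop.1 (eventually_matPow_le hρ i j)
  -- Borel–Cantelli over generations, shifted by `N` to where the geometric bound is valid.
  have hsum : ∑' n, treeProb P i {t | ∃ I : List (Ty d × ℕ), (I.length = n + N ∧
      typeOf (i.1, I) = j) ∧ Born (restrictTo B i t) I} ≠ ∞ := by
    refine ne_of_lt (lt_of_le_of_lt (b := ∑' n, ρ ^ n) (ENNReal.tsum_le_tsum fun n => ?_) ?_)
    · calc _ ≤ meanCount P B i (n + N) j := by
            rw [ofPred_exists]
            refine (measure_iUnion_le _).trans (ENNReal.tsum_le_tsum fun I => ?_)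
            split_ifs with hI <;> simp [hI]
        _ ≤ ρ ^ (n + N) := by
            rw [meanCount_eq_matPow]
            exact hN _ (Nat.le_add_left N n)
        _ ≤ ρ ^ n := pow_le_pow_right_of_le_one' hρ1.le (Nat.le_add_right n N)
    · rw [ENNReal.tsum_geometric]
      exact ENNReal.inv_lt_top.2 (tsub_pos_of_lt hρ1)
  filter_upwards [ae_finite_setOfPred_mem hsum] with t ht
  obtain ⟨m, hm⟩ := ht.bddAbove
  refine ⟨m + 1 + N, fun I hI hj hb => ?_⟩
  have : I.length - N ≤ m := hm ⟨I, ⟨by omega, hj⟩, hb⟩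
  omega

theorem ae_mem_partial_of_survivesWithin {B : Set (Ty d)}
    (hnu : convNorm (subMatrix P B) < 1) {i : Ty d} (hi : i ∈ B) :
    ∀ᵐ t ∂treeProb P i, t ∈ survivesWithin i B →
      t ∈ ⋂ k, treeExtinct i (upToLevel d k) := by
  have h := ae_all_iff.2 fun j : B =>
    ae_restrictTo_mem_treeExtinct_singleton P hnu ⟨i, hi⟩ j
  filter_upwards [h] with t ht hs
  refine mem_iInter.2 fun k => mem_treeExtinct_of_finite (finite_upToLevel k) fun j _ => ?_
  rw [← treeExtinct_iff_of_mem_survivesWithin hs]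
  by_cases hj : j ∈ B
  · exact ht ⟨j, hj⟩
  · refine ⟨0, fun I _ hI hb => hj ?_⟩
    rw [mem_singleton_iff] at hI
    exact hI ▸ hs.2 I hb

/-! ### Extinction in a set that can be reached from every type -/

/-- Follow the path through first children: a positive mean gives a positive probability of at least
one child. -/
theorem exists_treeProb_born_pos {i j : Ty d}
    (h : Relation.ReflTransGen (fun a b => 0 < meanMatrix P a b) i j) :
    ∃ I, typeOf (i, I) = j ∧ 0 < treeProb P i {t | Born t I} := by
  induction h with
  | refl => exact ⟨[], rfl, by simp [Born]⟩
  | @tail j l _ hjl ih =>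
    obtain ⟨I, hI, hpos⟩ := ih
    refine ⟨(l, 0) :: I, rfl, ?_⟩
    have h1 := treeProb_born_cons P (mem_univ (typeOf (i, I))) l 0
    simp only [restrictTo_univ] at h1
    rw [h1]
    refine ENNReal.mul_pos hpos.ne' ?_
    rw [hI]
    intro h0
    refine hjl.ne' (ENNReal.tsum_eq_zero.2 fun r => ?_)
    rw [PMF.toMeasure_apply_eq_zero_iff _ MeasurableSet.of_discrete, disjoint_left] at h0
    by_cases hr : r ∈ (P.law j).support
    · have : r l = 0 := by simpa using h0 hr
      simp [this]
    · rw [(PMF.apply_eq_zero_iff _ _).2 hr, zero_mul]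

/-- The filtration of the generations. -/
def generationFiltration (d : ℕ) :
    Filtration ℕ (MeasurableSpace.pi : MeasurableSpace (Tree d)) where
  seq n := sigmaOf {J | J.length < n}
  mono' _ _ h := sigmaOf_mono fun _ hJ => lt_of_lt_of_le hJ h
  le' _ := sigmaOf_le _

theorem iSup_generationFiltration (d : ℕ) :
    ⨆ n, generationFiltration d n = (MeasurableSpace.pi : MeasurableSpace (Tree d)) := by
  refine le_antisymm (iSup_le fun n => sigmaOf_le _) (iSup_le fun I => ?_)
  refine le_trans ?_ (le_iSup (fun n => generationFiltration d n) (I.length + 1))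
  exact le_iSup₂ (f := fun (J : List (Ty d × ℕ)) (_ : J ∈ {J | J.length < I.length + 1}) =>
    MeasurableSpace.comap (fun t : Tree d => t J) ⊤) I (Nat.lt_succ_self _)

/-- The trees with root type `φ` that have no individual with type in `B` from generation `n`
on. -/
def absentFrom (φ : Ty d) (B : Set (Ty d)) (n : ℕ) : Set (Tree d) :=
  {t | ∀ I, n ≤ I.length → typeOf (φ, I) ∈ B → ¬ Born t I}

/-- Whether `I` is born is known by its generation. If it is, absence of `B` passes to its subtree,
which is independent of the past. -/
theorem ae_condExp_absentFrom_le (φ : Ty d) (B : Set (Ty d)) {n : ℕ} {I : List (Ty d × ℕ)}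
    (hI : n ≤ I.length) :
    ∀ᵐ t ∂treeProb P φ, Born t I →
      (treeProb P φ)[(absentFrom φ B n).indicator (fun _ => (1 : ℝ)) |
        generationFiltration d I.length] t ≤
        (treeProb P (typeOf (φ, I))).real (absentFrom (typeOf (φ, I)) B 0) := by
  set μ := treeProb P φ with hμ
  set ℱ := generationFiltration d with hℱ
  set E := absentFrom φ B n with hE
  set N := absentFrom (typeOf (φ, I)) B 0 with hN
  have hEm : MeasurableSet E := measurableSet_not_born φ B n
  have hNm : MeasurableSet N := measurableSet_not_born _ B 0
  set C : Set (Tree d) := {t | Born t I} with hC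
  have hCm : MeasurableSet[ℱ I.length] C := measurableSet_born_sigmaOf I le_rfl φ
  have hint : Integrable (E.indicator fun _ => (1 : ℝ)) μ :=
    (integrable_const 1).indicator hEm
  have hSm : MeasurableSet (subtree I ⁻¹' N) := measurable_subtree I hNm
  have hint' : Integrable ((subtree I ⁻¹' N).indicator fun _ => (1 : ℝ)) μ :=
    (integrable_const 1).indicator hSm
  have hle : C.indicator (E.indicator fun _ => (1 : ℝ)) ≤
      (subtree I ⁻¹' N).indicator fun _ => (1 : ℝ) := by
    intro t
    by_cases htC : t ∈ C
    · by_cases htE : t ∈ E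
      · have : t ∈ subtree I ⁻¹' N := by
          intro L _ hL hb
          refine htE (L ++ I) (by simp; omega) ?_ ((born_append t L I).2 ⟨htC, hb⟩)
          rwa [typeOf_append]
        simp [htC, htE, this]
      · simp only [htC, htE, indicator_of_mem, indicator_of_notMem, not_false_eq_true]
        exact indicator_nonneg (fun _ _ => zero_le_one) _
    · rw [indicator_of_notMem htC]
      exact indicator_nonneg (fun _ _ => zero_le_one) _
  have h1 := condExp_indicator (m := ℱ I.length) hint hCm
  have h2 : μ[C.indicator (E.indicator fun _ => (1 : ℝ)) | ℱ I.length] ≤ᵐ[μ]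
      μ[(subtree I ⁻¹' N).indicator (fun _ => (1 : ℝ)) | ℱ I.length] :=
    condExp_mono (hint.indicator (ℱ.le _ _ hCm)) hint' (ae_of_all _ hle)
  have hd : Disjoint {J : List (Ty d × ℕ) | I.length ≤ J.length} {J | J.length < I.length} :=
    disjoint_left.2 fun J (h1 : I.length ≤ J.length) => not_lt.2 h1
  have hsub : Measurable[sigmaOf {J : List (Ty d × ℕ) | I.length ≤ J.length}]
      (subtree (d := d) I) := by
    refine (@measurable_pi_iff (Tree d) _ _ (sigmaOf _) _ _).2 fun L s _ => ?_
    exact measurableSet_sigmaOf (show I.length ≤ (L ++ I).length by simp) (fun r => r ∈ s)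
  have h3 : μ[(subtree I ⁻¹' N).indicator (fun _ => (1 : ℝ)) | ℱ I.length] =ᵐ[μ]
      fun _ => ∫ t, (subtree I ⁻¹' N).indicator (fun _ => (1 : ℝ)) t ∂μ :=
    condExp_indep_eq (sigmaOf_le _) (ℱ.le _)
      (stronglyMeasurable_const.indicator (hsub hNm)) (indep_sigmaOf P φ hd)
  have h4 : ∫ t, (subtree I ⁻¹' N).indicator (fun _ => (1 : ℝ)) t ∂μ =
      (treeProb P (typeOf (φ, I))).real N := by
    rw [integral_indicator_const _ hSm, smul_eq_mul, mul_one, measureReal_def,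
      treeProb_subtree P φ I hNm, measureReal_def]
  filter_upwards [h1, h2, h3] with t ht1 ht2 ht3 htb
  rw [ht1, ht3, h4, indicator_of_mem (show t ∈ C from htb)] at ht2
  exact ht2

theorem ae_treeExtinct_singleton_of_treeExtinct {B : Set (Ty d)} {j : Ty d}
    (hj : treeProb P j (absentFrom j B 0) < 1) (φ : Ty d) :
    ∀ᵐ t ∂treeProb P φ, t ∈ treeExtinct φ B → t ∈ treeExtinct φ {j} := by
  have key : ∀ n, ∀ᵐ t ∂treeProb P φ, t ∈ absentFrom φ B n → t ∈ treeExtinct φ {j} := by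
    intro n
    have hEm : MeasurableSet (absentFrom φ B n) := measurableSet_not_born φ B n
    have hlim := Integrable.tendsto_ae_condExp (μ := treeProb P φ)
      (ℱ := generationFiltration d)
      (g := (absentFrom φ B n).indicator (fun _ => (1 : ℝ)))
      ((integrable_const 1).indicator hEm)
      (by
        rw [iSup_generationFiltration]
        exact stronglyMeasurable_const.indicator hEm)
    have hle := ae_all_iff.2 fun I : {I : List (Ty d × ℕ) // n ≤ I.length} =>
      ae_condExp_absentFrom_le P φ B I.2
    filter_upwards [hlim, hle] with t ht1 ht2 htE
    by_contra hcon
    rw [indicator_of_mem htE] at ht1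
    have hc : (treeProb P j).real (absentFrom j B 0) < 1 := by
      rw [measureReal_def]
      exact ENNReal.toReal_lt_of_lt_ofReal (by simpa using hj)
    -- On the event the conditional probabilities tend to 1, but each generation containing type `j`
    -- keeps them at most a constant below 1.
    obtain ⟨N, hN⟩ := eventually_atTop.1 (ht1.eventually (lt_mem_nhds hc))
    simp only [treeExtinct, mem_ofPred_eq, not_exists, not_forall, not_not] at hcon
    obtain ⟨I, hI, hIj, hb⟩ := hcon (max n N)
    rw [mem_singleton_iff] at hIj
    have h1 := ht2 ⟨I, (le_max_left n N).trans hI⟩ hb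
    have h2 := hN I.length ((le_max_right n N).trans hI)
    simp only [hIj] at h1
    exact absurd h1 (not_le.2 h2)
  filter_upwards [ae_all_iff.2 key] with t ht h
  obtain ⟨n, hn⟩ := h
  exact ht n hn

theorem treeProb_absentFrom_lt_one (hirr : Irreducible P) {B : Set (Ty d)} (hB : B.Nonempty)
    (j : Ty d) : treeProb P j (absentFrom j B 0) < 1 := by
  obtain ⟨b, hb⟩ := hB
  obtain ⟨I, hI, hpos⟩ := exists_treeProb_born_pos P (hirr j b)
  refine lt_of_le_of_ne prob_le_one fun h => hpos.ne' ?_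
  refine measure_mono_null ?_
    ((prob_compl_eq_zero_iff (measurableSet_not_born j B 0)).2 h)
  intro t ht hn
  exact hn I (Nat.zero_le _) (hI ▸ hb) ht

theorem ae_mem_partial_of_treeExtinct (hirr : Irreducible P) {B : Set (Ty d)}
    (hB : B.Nonempty) (φ : Ty d) :
    ∀ᵐ t ∂treeProb P φ, t ∈ treeExtinct φ B → t ∈ ⋂ k, treeExtinct φ (upToLevel d k) := by
  have h := ae_all_iff.2 fun j : Ty d =>
    ae_treeExtinct_singleton_of_treeExtinct P (treeProb_absentFrom_lt_one P hirr hB j) φ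
  filter_upwards [h] with t ht hext
  exact mem_iInter.2 fun k => mem_treeExtinct_of_finite (finite_upToLevel k) fun j _ => ht j hext

end Escape

/-! ### Strict comparison of probabilities and the conclusion -/

theorem measure_lt_measure_of_ae_disjoint {Ω : Type*} [MeasurableSpace Ω] {μ : Measure Ω}
    [IsFiniteMeasure μ] {s t e : Set Ω} (he : MeasurableSet e) (hst : s ≤ᵐ[μ] t)
    (het : e ≤ᵐ[μ] t) (hd : Disjoint s e) (hpos : 0 < μ e) : μ s < μ t :=
  calc μ s < μ s + μ e := ENNReal.lt_add_right (measure_ne_top μ s) hpos.ne'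
    _ = μ (s ∪ e) := (measure_union hd he).symm
    _ ≤ μ t := measure_mono_ae (by
        filter_upwards [hst, het] with x h1 h2 h
        exact h.elim h1 h2)

end BlockLHBP

theorem mainTheorem2 (d : ℕ) (P : BlockLHBP.OffspringLaws d) (A : Set (BlockLHBP.Ty d))
    (hA : MeasurableSet[BlockLHBP.phaseSigma d] A)
    (hsurv : ∃ φ : Fin d, BlockLHBP.qSterile P Aᶜ (0, φ) < 1)
    (hnu : BlockLHBP.convNorm (BlockLHBP.subMatrix P Aᶜ) < 1)
    (hcondA : ∀ p : BlockLHBP.phases Aᶜ,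
      ∑' k : ℕ, (∑ r, BlockLHBP.tVec P A k r) *
        (Matrix.mulVec (BlockLHBP.stepUpProd (BlockLHBP.subBlock P Aᶜ) k) 1) p < ∞)
    (hcondB : ∃ K : ℝ≥0, ∀ k : ℕ, ∀ i j : ↥(Aᶜ), i.1.1 = k → j.1.1 = k →
      BlockLHBP.firstPassageSum (BlockLHBP.subMatrix P Aᶜ) i j ≤ K) :
    BlockLHBP.qGlobal P < BlockLHBP.qSet P A ∧
      (BlockLHBP.Irreducible P → BlockLHBP.qSet P Aᶜ < BlockLHBP.qPartial P) := by
  open BlockLHBP in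
  obtain ⟨φ, hφ⟩ := hsurv
  -- A root in `A` would be sterile, hence extinct from generation 1 on.
  have hφA : ((0, φ) : Ty d) ∈ Aᶜ := by
    intro h
    refine hφ.ne ?_
    rw [qSterile_eq]
    refine (measure_congr (ae_of_all _ fun t => ?_)).trans measure_univ
    refine eq_true ⟨1, fun I hI _ hb => ?_⟩
    have hI0 := eq_nil_of_born (if_neg (not_not.2 h)) hb
    simp [hI0] at hI
  have hfin := tsum_green_mul_lt_top hA hnu hcondA hcondB ⟨(0, φ), hφA⟩ rfl
  obtain ⟨i, hi, hpos⟩ := exists_treeProb_survivesWithin_pos P ⟨(0, φ), hφA⟩ hfin hφ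
  have hmono : ∀ {φ : Ty d} {B C : Set (Ty d)}, B ⊆ C → treeExtinct φ C ⊆ treeExtinct φ B :=
    fun h _ ⟨n, hn⟩ => ⟨n, fun I hI hB => hn I hI (h hB)⟩
  refine ⟨Pi.lt_def.2 ⟨fun φ => ?_, i, ?_⟩, fun hirr => Pi.lt_def.2 ⟨fun φ => ?_, i, ?_⟩⟩
  · rw [qGlobal, qSet_eq, qSet_eq]
    exact measure_mono (hmono (subset_univ A))
  · rw [qGlobal, qSet_eq, qSet_eq]
    refine measure_lt_measure_of_ae_disjoint (measurableSet_survivesWithin i Aᶜ)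
      (ae_of_all _ (hmono (subset_univ A))) (ae_of_all _ fun t ht => ?_)
      (disjoint_left.2 fun t h1 h2 => ?_) hpos
    · exact ⟨0, fun I _ hI hb => ht.2 I ((born_iff_of_forall_mem ht.2 I).2 hb) hI⟩
    · exact h2.1 ((treeExtinct_iff_of_mem_survivesWithin h2 univ).2 h1)
  · rw [qSet_eq, qPartial_eq]
    exact measure_mono_ae (ae_mem_partial_of_treeExtinct P hirr ⟨i, hi⟩ φ)
  · rw [qSet_eq, qPartial_eq]
    refine measure_lt_measure_of_ae_disjoint (measurableSet_survivesWithin i Aᶜ)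
      (ae_mem_partial_of_treeExtinct P hirr ⟨i, hi⟩ i)
      (ae_mem_partial_of_survivesWithin P hnu hi)
      (disjoint_left.2 fun t ⟨n, hn⟩ h2 => ?_) hpos
    -- Here the whole population lies in `Aᶜ`, so extinction in `Aᶜ` would be global extinction.
    refine h2.1 ⟨n, fun I hI _ hb => hn I hI (h2.2 I hb) ?_⟩
    exact (born_iff_of_forall_mem h2.2 I).1 hb
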